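/- Let $I=[-1,1]$ with Lebesgue measure $\mathrm{Leb}$ and normalised Lebesgue measure $\overline{\mathrm{Leb}}=\tfrac12\mathrm{Leb}$. For $a,b\in[0,1]$ let $T_{a,b}:I\to I$ be the paired tent map $$T_{a,b}(x)=\begin{cases}2(1+b)(x+1)-1,& x\in[-1,-\tfrac12]\\ -2(1+b)x-1,& x\in[-\tfrac12,0)\\ 0,& x=0\\ -2(1+a)x+1,& x\in(0,\tfrac12]\\ 2(1+a)(x-1)+1,& x\in[\tfrac12,1].\end{cases}$$ Let $\sigma$ be an ergodic, measure-preserving, invertible (bi-measurable) transformation of a probability space $(\Omega,\mathcal F,\mathbb P)$, and let $a,b:\Omega\to[0,1]$ be measurable with $\int_\Omega (a_\omega+b_\omega)\,d\mathbb P(\omega)\neq 0$. Let $E$ be the set of all $\varepsilon\ge 0$ with $\varepsilon a_\omega\le 1$ and $\varepsilon b_\omega\le 1$ for every $\omega$ (so $[0,1]\subseteq E$). For $\varepsilon\in E$ put $T^\varepsilon_\omega=T_{\varepsilon a_\omega,\varepsilon b_\omega}$, and assume that $\omega\mapsto T^\varepsilon_\omega$ has finite range and that $(\omega,x)\mapsto(\sigma\omega,T^\varepsilon_\omega(x))$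 is measurable. Let $\mathcal L^\varepsilon_\omega$ be the Perron-Frobenius operator of $T^\varepsilon_\omega$, i.e. $\int_D\mathcal L^\varepsilon_\omega f\,d\mathrm{Leb}=\int_{(T^\varepsilon_\omega)^{-1}(D)}f\,d\mathrm{Leb}$ for all $f\in L^1(\mathrm{Leb})$ and all Borel $D\subseteq I$, and let $\mathcal L^{\varepsilon\,(n)}_\omega=\mathcal L^\varepsilon_{\sigma^{n-1}\omega}\circ\cdots\circ\mathcal L^\varepsilon_\omega$ (the identity for $n=0$). For $f\in L^1(\mathrm{Leb})$ let $\mathrm{Var}(f)\in[0,\infty]$ be the infimum of the total variations on $I$ of the functions equal to $f$ almost everywhere, let $\mathrm{BV}(I)=\{f\in L^1(\mathrm{Leb}):\mathrm{Var}(f)<\infty\}$, and let $\|f\|_{\mathrm{BV}}=\mathrm{Var}(f)+\|f\|_{L^1(\mathrm{Leb})}$. Then for all $\varepsilon\in E$, $\omega\in\Omega$, $f\in\mathrm{BV}(I)$ and $n\in\mathbb N=\{0,1,2,\dots\}$, $$\mathrm{Var}\big(\mathcal L^{\varepsilon\,(n)}_\omega f\big)\le\left(\tfrac34\right)^{\lfloor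 n/2\rfloor}\mathrm{Var}(f)+26\,\|f\|_{L^1(\overline{\mathrm{Leb}})}.$$ Consequently the cocycles satisfy a uniform Lasota-Yorke inequality: there are constants $C_1,C_2>0$ and $0<r<R\le1$, independent of $\omega$, $\varepsilon$, $f$ and $n$, such that for all $\varepsilon\in E$, $\omega\in\Omega$, $f\in\mathrm{BV}(I)$ and $n\in\mathbb N$ one has $\mathcal L^{\varepsilon\,(n)}_\omega f\in\mathrm{BV}(I)$ and $$\|\mathcal L^{\varepsilon\,(n)}_\omega f\|_{\mathrm{BV}}\le C_1r^n\|f\|_{\mathrm{BV}}+C_2R^n\|f\|_{L^1(\mathrm{Leb})}.$$ -/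

import Mathlib

open MeasureTheory Set
open scoped ENNReal NNReal

namespace PairedTent

noncomputable section

/-- The interval `I = [-1, 1]`. -/
def I : Set ℝ := Icc (-1) 1

/-- Lebesgue measure on `I`, as a measure on `ℝ` carried by `I`. -/
def lebI : Measure ℝ := volume.restrict I

/-- Normalised Lebesgue measure on `I` (total mass one, since `I` has length two). -/
def normLebI : Measure ℝ := (2 : ℝ≥0∞)⁻¹ • lebI

/-- The paired tent map `T_{a,b}` on `I`. The formulas are used on all of `ℝ`; only the values on
`I` matter, because every measure below is carried by `I`. -/
def pairedTent (a b x : ℝ) : ℝ :=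
  if x ≤ -1 / 2 then 2 * (1 + b) * (x + 1) - 1
  else if x < 0 then -2 * (1 + b) * x - 1
  else if x = 0 then 0
  else if x ≤ 1 / 2 then -2 * (1 + a) * x + 1
  else 2 * (1 + a) * (x - 1) + 1

/-- The Perron-Frobenius operator of `T` on `L¹(μ)`: `𝓛_T f` is the density with respect to `μ` of
the image under `T` of the signed measure `f dμ`. -/
def perronFrobenius {α : Type*} [MeasurableSpace α] (μ : Measure α) (T : α → α) (f : α → ℝ) :
    α → ℝ :=
  SignedMeasure.rnDeriv ((μ.withDensityᵥ f).map T) μ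

/-- The cocycle `L_ω^{(n)} = L_{σ^{n-1} ω} ∘ ⋯ ∘ L_ω`. -/
def cocycle {Ω X : Type*} (σ : Ω → Ω) (L : Ω → X → X) : ℕ → Ω → X → X
  | 0, _, f => f
  | n + 1, ω, f => L (σ^[n] ω) (cocycle σ L n ω f)

/-- The random paired tent map `T_ω^ε = T_{ε a_ω, ε b_ω}`. -/
def randomTent {Ω : Type*} (a b : Ω → ℝ) (ε : ℝ) (ω : Ω) : ℝ → ℝ :=
  pairedTent (ε * a ω) (ε * b ω)

/-- The Perron-Frobenius operator `𝓛_ω^ε` of `T_ω^ε`. -/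
def tentOp {Ω : Type*} (a b : Ω → ℝ) (ε : ℝ) (ω : Ω) : (ℝ → ℝ) → (ℝ → ℝ) :=
  perronFrobenius lebI (randomTent a b ε ω)

/-- The values of `ε ≥ 0` for which all the maps `T_{ε a_ω, ε b_ω}` are paired tent maps, i.e. have
both parameters in `[0, 1]`. If `a` and `b` take values in `[0, 1]`, it contains `[0, 1]`. -/
def Admissible {Ω : Type*} (a b : Ω → ℝ) (ε : ℝ) : Prop :=
  0 ≤ ε ∧ ∀ ω, ε * a ω ≤ 1 ∧ ε * b ω ≤ 1

/-- The variation on `I` of the class of `f` modulo almost everywhere equality: the least total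
variation of a representative. -/
def Var (f : ℝ → ℝ) : ℝ≥0∞ :=
  ⨅ (g : ℝ → ℝ) (_ : g =ᵐ[lebI] f), eVariationOn g I

/-- `f` represents an element of `BV(I)`. -/
def MemBV (f : ℝ → ℝ) : Prop :=
  MemLp f 1 lebI ∧ Var f ≠ ∞

/-- The norm of `BV(I)`. -/
def bvNorm (f : ℝ → ℝ) : ℝ≥0∞ :=
  Var f + eLpNorm f 1 lebI

/-- Uniform Lasota-Yorke inequality on `BV(I)` with weak norm `L¹(Leb)`, for a family of cocycles
over `σ` with generators `L ε`, uniform over all `ω` and over all `ε` with `E ε`. -/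
def UniformLasotaYorke {Ω : Type*} (σ : Ω → Ω) (E : ℝ → Prop)
    (L : ℝ → Ω → (ℝ → ℝ) → (ℝ → ℝ)) : Prop :=
  ∃ C₁ C₂ r R : ℝ≥0, 0 < C₁ ∧ 0 < C₂ ∧ 0 < r ∧ r < R ∧ R ≤ 1 ∧
    ∀ ε, E ε → ∀ (ω : Ω) (f : ℝ → ℝ), MemBV f → ∀ n : ℕ,
      MemBV (cocycle σ (L ε) n ω f) ∧
      bvNorm (cocycle σ (L ε) n ω f) ≤
        C₁ * (r : ℝ≥0∞) ^ n * bvNorm f + C₂ * (R : ℝ≥0∞) ^ n * eLpNorm f 1 lebI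

/-- `T_{a,b}` maps `I` to itself. -/
theorem mapsTo_pairedTent {a b : ℝ} (ha : a ∈ Icc (0 : ℝ) 1) (hb : b ∈ Icc (0 : ℝ) 1) :
    MapsTo (pairedTent a b) I I := by
  intro x hx
  simp only [I, mem_Icc] at *
  unfold pairedTent
  split_ifs <;> constructor <;> nlinarith

/-- The Perron-Frobenius operator has its defining property for every non-singular map. -/
theorem setIntegral_perronFrobenius {α : Type*} [MeasurableSpace α] {μ : Measure α} [SigmaFinite μ]
    {T : α → α} (hT : Measure.QuasiMeasurePreserving T μ μ) {f : α → ℝ} (hf : Integrable f μ) :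
    Integrable (perronFrobenius μ T f) μ ∧ ∀ D, MeasurableSet D →
      ∫ x in D, perronFrobenius μ T f x ∂μ = ∫ x in T ⁻¹' D, f x ∂μ := by
  have hi : Integrable (perronFrobenius μ T f) μ := SignedMeasure.integrable_rnDeriv _ _
  refine ⟨hi, fun D hD => ?_⟩
  have hac : ((μ.withDensityᵥ f).map T) ≪ᵥ μ.toENNRealVectorMeasure := by
    refine VectorMeasure.AbsolutelyContinuous.mk fun D hD h0 => ?_
    rw [Measure.toENNRealVectorMeasure_apply_measurable hD] at h0
    rw [VectorMeasure.map_apply _ hT.measurable hD,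
      withDensityᵥ_apply hf (hT.measurable hD)]
    exact setIntegral_measure_zero _ (hT.preimage_null h0)
  have h := (SignedMeasure.absolutelyContinuous_iff_withDensityᵥ_rnDeriv_eq _ μ).1 hac
  have h2 := congrArg (fun v : SignedMeasure α => v D) h
  rw [withDensityᵥ_apply (SignedMeasure.integrable_rnDeriv _ _) hD,
    VectorMeasure.map_apply _ hT.measurable hD, withDensityᵥ_apply hf (hT.measurable hD)] at h2
  exact h2

theorem measurable_pairedTent (a b : ℝ) : Measurable (pairedTent a b) := by
  unfold pairedTent
  refine Measurable.ite measurableSet_Iic (by fun_prop) ?_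
  refine Measurable.ite measurableSet_Iio (by fun_prop) ?_
  refine Measurable.ite (measurableSet_singleton 0) (by fun_prop) ?_
  exact Measurable.ite measurableSet_Iic (by fun_prop) (by fun_prop)

/-- `T_{a,b}` is non-singular. -/
theorem quasiMeasurePreserving_pairedTent {a b : ℝ} (ha : a ∈ Icc (0 : ℝ) 1)
    (hb : b ∈ Icc (0 : ℝ) 1) :
    Measure.QuasiMeasurePreserving (pairedTent a b) lebI lebI := by
  refine ⟨measurable_pairedTent a b, Measure.AbsolutelyContinuous.mk fun D hD h0 => ?_⟩
  have hI : MeasurableSet I := measurableSet_Icc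
  rw [Measure.map_apply (measurable_pairedTent a b) hD, lebI,
    Measure.restrict_apply (measurable_pairedTent a b hD)]
  rw [lebI, Measure.restrict_apply hD] at h0
  have key : ∀ c d : ℝ, c ≠ 0 → volume ((fun x : ℝ => c * x + d) ⁻¹' (D ∩ I)) = 0 := by
    intro c d hc
    have : (fun x : ℝ => c * x + d) ⁻¹' (D ∩ I)
        = (fun x : ℝ => c * x) ⁻¹' ((fun x : ℝ => x + d) ⁻¹' (D ∩ I)) := rfl
    rw [this, Real.volume_preimage_mul_left hc, measure_preimage_add_right, h0, mul_zero]
  have ha' : 1 + a ≠ 0 := by have := ha.1; positivity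
  have hb' : 1 + b ≠ 0 := by have := hb.1; positivity
  refine measure_mono_null (t := (fun x : ℝ => (2 * (1 + b)) * x + (2 * (1 + b) - 1)) ⁻¹' (D ∩ I)
      ∪ (fun x : ℝ => (-2 * (1 + b)) * x + (-1)) ⁻¹' (D ∩ I) ∪ {0}
      ∪ (fun x : ℝ => (-2 * (1 + a)) * x + 1) ⁻¹' (D ∩ I)
      ∪ (fun x : ℝ => (2 * (1 + a)) * x + (1 - 2 * (1 + a))) ⁻¹' (D ∩ I)) ?_ ?_
  · rintro x ⟨hx, hxI⟩
    have hmem : pairedTent a b x ∈ D ∩ I := ⟨hx, mapsTo_pairedTent ha hb hxI⟩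
    unfold pairedTent at hmem
    simp only [mem_union, mem_preimage, mem_singleton_iff]
    split_ifs at hmem
    · left; left; left; left; convert hmem using 1; ring
    · left; left; left; right; convert hmem using 1; ring
    · left; left; right; assumption
    · left; right; exact hmem
    · right; convert hmem using 1; ring
  · simp only [measure_union_null_iff]
    refine ⟨⟨⟨⟨key _ _ ?_, key _ _ ?_⟩, by simp⟩, key _ _ ?_⟩, key _ _ ?_⟩ <;> simpa

end

end PairedTent

namespace PairedTent

/-! On each half of `I` the map is a tent with slopes `±2A`, where `A = 1 + b` on the left and `A =
1 + a` on the right. So the transfer operator has an explicit version `tentTransfer`: the sum of one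
`fold` for each half. Within the image of a half, the variation is scaled by `(2A)⁻¹`. At the image
of the peak the fold drops to zero, a jump of height at most `(2A)⁻¹ * (2 * |g|)` with `g` taken at
the midpoint of the half.

Since `2 * |g|` at the midpoint costs up to the variation on that half plus an integral, one step
only gives the factor `1` when `A = 1`, with no contraction. Two steps do contract. The second step
sees half of the variation of `G = tentTransfer a b g`, plus `|G (-1/2)| + |G (1/2)|`, and these two
values come from explicit preimages under the first map. The contributions of the two halves of `I`
decouple, and each is at most `3/4` of its variation plus `13/4` of its integral
(`sum_abs_jumps_le`, `two_step_half_le`).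

Taking the infimum over representatives transfers this to `Var`. Iteration in pairs together with
the `L¹` contraction gives the weak constant `13`, the fixed point of `K ↦ 3/4 * K + 13/4`; it
becomes `26` for the normalised measure. -/

/-! ### The pointwise transfer operator and its duality with composition. -/

/-- The two-branched full tent on `[-1, 0]` with slopes `±2A`, normalised to vanish at both ends. -/
noncomputable def tent (A t : ℝ) : ℝ :=
  if t ≤ -1 / 2 then 2 * A * (t + 1) else -(2 * A * t)

/-- The transfer operator of `tent A`, evaluated pointwise. -/
noncomputable def fold (A : ℝ) (g : ℝ → ℝ) (u : ℝ) : ℝ :=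
  if u ≤ A then (2 * A)⁻¹ * (g ((2 * A)⁻¹ * u + -1) + g (-(2 * A)⁻¹ * u + 0)) else 0

/-- An everywhere defined version of the Perron-Frobenius operator of `pairedTent a b`. -/
noncomputable def tentTransfer (a b : ℝ) (g : ℝ → ℝ) (x : ℝ) : ℝ :=
  fold (1 + b) g (x + 1) + fold (1 + a) (fun t => g (-t)) (1 - x)

theorem intervalIntegrable_bdd_mul {k g : ℝ → ℝ} {p q : ℝ} (hk : Measurable k)
    (hk1 : ∀ u, |k u| ≤ 1) (hg : IntervalIntegrable g volume p q) :
    IntervalIntegrable (fun t => k t * g t) volume p q := by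
  rw [intervalIntegrable_iff] at hg ⊢
  exact Integrable.bdd_mul hg hk.aestronglyMeasurable (Filter.Eventually.of_forall hk1)

theorem intervalIntegrable_comp_affine {h : ℝ → ℝ} {p q c d : ℝ} (hc : c ≠ 0)
    (hh : IntervalIntegrable h volume (c * p + d) (c * q + d)) :
    IntervalIntegrable (fun u => h (c * u + d)) volume p q := by
  have h1 := (hh.comp_add_right d).comp_mul_left (c := c)
  simpa [hc] using h1

/-- Change of variables on the two branches of `tent A`. The test function `k` serves twice:
constant for integrability, an indicator for the defining identity of the Perron-Frobenius operator.
-/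
theorem intervalIntegral_mul_fold {A : ℝ} (hA : A ∈ Icc (1 : ℝ) 2) {g k : ℝ → ℝ}
    (hg : IntervalIntegrable g volume (-1) 0) (hk : Measurable k) (hk1 : ∀ u, |k u| ≤ 1) :
    IntervalIntegrable (fun u => k u * fold A g u) volume 0 2 ∧
      ∫ u in (0 : ℝ)..2, k u * fold A g u = ∫ t in (-1 : ℝ)..0, k (tent A t) * g t := by
  obtain ⟨hA1, hA2⟩ := hA
  set c := (2 * A)⁻¹ with hc
  have hc0 : c ≠ 0 := by positivity
  have hcA : c * A = 1 / 2 := by rw [hc]; field_simp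
  have hAc : 2 * A * c = 1 := by rw [hc]; field_simp
  have hgl : IntervalIntegrable g volume (-1) (-1 / 2) :=
    hg.mono_set (by rw [uIcc_of_le (by norm_num), uIcc_of_le (by norm_num)]
                    exact Icc_subset_Icc le_rfl (by norm_num))
  have hgr : IntervalIntegrable g volume (-1 / 2) 0 :=
    hg.mono_set (by rw [uIcc_of_le (by norm_num), uIcc_of_le (by norm_num)]
                    exact Icc_subset_Icc (by norm_num) le_rfl)
  set h₁ : ℝ → ℝ := fun t => k (2 * A * (t + 1)) * g t with hh₁
  set h₂ : ℝ → ℝ := fun t => k (-(2 * A * t)) * g t with hh₂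
  have i₁ : IntervalIntegrable h₁ volume (-1) (-1 / 2) :=
    intervalIntegrable_bdd_mul (hk.comp (by fun_prop)) (fun u => hk1 _) hgl
  have i₂ : IntervalIntegrable h₂ volume (-1 / 2) 0 :=
    intervalIntegrable_bdd_mul (hk.comp (by fun_prop)) (fun u => hk1 _) hgr
  have j₁ : IntervalIntegrable (fun u => h₁ (c * u + -1)) volume 0 A := by
    apply intervalIntegrable_comp_affine hc0
    rw [hcA]; convert i₁ using 1 <;> norm_num
  have j₂ : IntervalIntegrable (fun u => h₂ (-c * u + 0)) volume 0 A := by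
    apply intervalIntegrable_comp_affine (neg_ne_zero.2 hc0)
    rw [neg_mul c A, hcA]; convert i₂.symm using 1 <;> norm_num
  have e₁ : EqOn (fun u => c * (h₁ (c * u + -1) + h₂ (-c * u + 0)))
      (fun u => k u * fold A g u) (uIoo 0 A) := by
    intro u hu
    rw [uIoo_of_le (by linarith)] at hu
    have e1 : 2 * A * (c * u + -1 + 1) = u := by
      linear_combination u * hAc
    have e2 : -(2 * A * (-c * u + 0)) = u := by
      linear_combination u * hAc
    simp only [hh₁, hh₂, e1, e2, fold, if_pos hu.2.le, ← hc]
    ring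
  have e₂ : EqOn (fun _ => (0 : ℝ)) (fun u => k u * fold A g u) (uIoo A 2) := by
    intro u hu
    rw [uIoo_of_le (by linarith)] at hu
    simp [fold, not_le.2 hu.1]
  have l₁ := ((j₁.add j₂).const_mul c).congr_uIoo e₁
  have l₂ := (intervalIntegrable_const (c := (0 : ℝ)) (μ := volume)).congr_uIoo e₂
  refine ⟨l₁.trans l₂, ?_⟩
  have f₁ : EqOn h₁ (fun t => k (tent A t) * g t) (uIoo (-1) (-1 / 2)) := by
    intro t ht
    rw [uIoo_of_le (by norm_num)] at ht
    simp [hh₁, tent, if_pos ht.2.le]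
  have f₂ : EqOn h₂ (fun t => k (tent A t) * g t) (uIoo (-1 / 2) 0) := by
    intro t ht
    rw [uIoo_of_le (by norm_num)] at ht
    simp [hh₂, tent, if_neg (not_le.2 ht.1)]
  rw [← intervalIntegral.integral_add_adjacent_intervals l₁ l₂,
    ← intervalIntegral.integral_add_adjacent_intervals (i₁.congr_uIoo f₁) (i₂.congr_uIoo f₂),
    ← intervalIntegral.integral_congr_uIoo e₁, ← intervalIntegral.integral_congr_uIoo e₂,
    ← intervalIntegral.integral_congr_uIoo f₁, ← intervalIntegral.integral_congr_uIoo f₂,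
    intervalIntegral.integral_const_mul, intervalIntegral.integral_add j₁ j₂,
    intervalIntegral.integral_comp_mul_add _ hc0,
    intervalIntegral.integral_comp_mul_add _ (neg_ne_zero.2 hc0), neg_mul c A, hcA]
  simp only [smul_eq_mul, intervalIntegral.integral_zero, add_zero, mul_zero, zero_add]
  rw [intervalIntegral.integral_symm (-(1 / 2)) 0]
  norm_num
  field_simp

theorem integrable_lebI_iff {f : ℝ → ℝ} :
    Integrable f lebI ↔ IntervalIntegrable f volume (-1) 1 :=
  (intervalIntegrable_iff_integrableOn_Icc_of_le (by norm_num)).symm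

theorem integral_lebI (f : ℝ → ℝ) : ∫ x, f x ∂lebI = ∫ x in (-1 : ℝ)..1, f x := by
  rw [intervalIntegral.integral_of_le (by norm_num), ← integral_Icc_eq_integral_Ioc]
  rfl

/-- On the left half `pairedTent` is `tent (1 + b) t - 1`; the right half reduces to the same fold
through the reflection `t ↦ -t`. -/
theorem integral_mul_tentTransfer {a b : ℝ} (ha : a ∈ Icc (0 : ℝ) 1) (hb : b ∈ Icc (0 : ℝ) 1)
    {g k : ℝ → ℝ} (hg : Integrable g lebI) (hk : Measurable k) (hk1 : ∀ u, |k u| ≤ 1) :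
    Integrable (fun x => k x * tentTransfer a b g x) lebI ∧
      ∫ x, k x * tentTransfer a b g x ∂lebI = ∫ t, k (pairedTent a b t) * g t ∂lebI := by
  rw [integrable_lebI_iff] at hg
  have hgl : IntervalIntegrable g volume (-1) 0 :=
    hg.mono_set (by rw [uIcc_of_le (by norm_num), uIcc_of_le (by norm_num)]
                    exact Icc_subset_Icc le_rfl (by norm_num))
  have hgr : IntervalIntegrable g volume 0 1 :=
    hg.mono_set (by rw [uIcc_of_le (by norm_num), uIcc_of_le (by norm_num)]
                    exact Icc_subset_Icc (by norm_num) le_rfl)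
  have hgr' : IntervalIntegrable (fun t => g (-t)) volume (-1) 0 := by
    have := intervalIntegrable_comp_affine (h := g) (c := -1) (d := 0) (p := -1) (q := 0)
      (by norm_num) (by simpa using hgr.symm)
    simpa using this
  obtain ⟨iL, eL⟩ := intervalIntegral_mul_fold (A := 1 + b) (k := fun u => k (u - 1))
    ⟨by linarith [hb.1], by linarith [hb.2]⟩ hgl (hk.comp (by fun_prop)) (fun u => hk1 _)
  obtain ⟨iR, eR⟩ := intervalIntegral_mul_fold (A := 1 + a) (k := fun u => k (1 - u))
    ⟨by linarith [ha.1], by linarith [ha.2]⟩ hgr' (hk.comp (by fun_prop)) (fun u => hk1 _)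
  have jL : IntervalIntegrable (fun x => k x * fold (1 + b) g (x + 1)) volume (-1) 1 := by
    have := iL.comp_add_right 1
    norm_num at this
    exact this
  have jR : IntervalIntegrable (fun x => k x * fold (1 + a) (fun t => g (-t)) (1 - x))
      volume (-1) 1 := by
    have := (iR.comp_sub_left 1).symm
    norm_num at this
    exact this
  have hsplit : (fun x => k x * tentTransfer a b g x) = fun x =>
      k x * fold (1 + b) g (x + 1) + k x * fold (1 + a) (fun t => g (-t)) (1 - x) := by
    funext x; rw [tentTransfer]; ring
  rw [integrable_lebI_iff, hsplit, integral_lebI, integral_lebI]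
  refine ⟨jL.add jR, ?_⟩
  have kT : IntervalIntegrable (fun t => k (pairedTent a b t) * g t) volume (-1) 1 :=
    intervalIntegrable_bdd_mul (hk.comp (measurable_pairedTent a b)) (fun u => hk1 _) hg
  have kl : IntervalIntegrable (fun t => k (pairedTent a b t) * g t) volume (-1) 0 :=
    kT.mono_set (by rw [uIcc_of_le (by norm_num), uIcc_of_le (by norm_num)]
                    exact Icc_subset_Icc le_rfl (by norm_num))
  have kr : IntervalIntegrable (fun t => k (pairedTent a b t) * g t) volume 0 1 :=
    kT.mono_set (by rw [uIcc_of_le (by norm_num), uIcc_of_le (by norm_num)]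
                    exact Icc_subset_Icc (by norm_num) le_rfl)
  have mL : ∫ x in (-1 : ℝ)..1, k x * fold (1 + b) g (x + 1) =
      ∫ t in (-1 : ℝ)..0, k (pairedTent a b t) * g t := by
    have := intervalIntegral.integral_comp_add_right (a := -1) (b := 1)
      (fun u => k (u - 1) * fold (1 + b) g u) 1
    norm_num at this
    rw [this, eL]
    apply intervalIntegral.integral_congr_uIoo
    intro t ht
    rw [uIoo_of_le (by norm_num)] at ht
    have : tent (1 + b) t - 1 = pairedTent a b t := by
      unfold tent pairedTent
      split_ifs <;> linarith [ht.2]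
    simp only [this]
  have mR : ∫ x in (-1 : ℝ)..1, k x * fold (1 + a) (fun t => g (-t)) (1 - x) =
      ∫ t in (0 : ℝ)..1, k (pairedTent a b t) * g t := by
    have := intervalIntegral.integral_comp_sub_left (a := -1) (b := 1)
      (fun u => k (1 - u) * fold (1 + a) (fun t => g (-t)) u) 1
    norm_num at this
    rw [this, eR]
    have h2 := intervalIntegral.integral_comp_neg (a := -1) (b := 0)
      (fun t => k (pairedTent a b t) * g t)
    norm_num at h2
    rw [← h2]
    apply intervalIntegral.integral_congr_uIoo
    intro t ht
    rw [uIoo_of_le (by norm_num)] at ht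
    have : 1 - tent (1 + a) t = pairedTent a b (-t) := by
      have h0 := ht.2
      unfold tent pairedTent
      split_ifs <;> first | (exfalso; linarith) | linarith | skip
      -- The reflection exchanges the closed sides of the branch intervals, so different formulas
      -- are selected at the peak, where they agree.
      have : t = -1 / 2 := by linarith
      subst this; ring
    simp only [this]
  rw [intervalIntegral.integral_add jL jR, mL, mR,
    intervalIntegral.integral_add_adjacent_intervals kl kr]

theorem integrable_tentTransfer {a b : ℝ} (ha : a ∈ Icc (0 : ℝ) 1) (hb : b ∈ Icc (0 : ℝ) 1)
    {g : ℝ → ℝ} (hg : Integrable g lebI) : Integrable (tentTransfer a b g) lebI := by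
  simpa using (integral_mul_tentTransfer ha hb hg (k := fun _ => 1) measurable_const (by simp)).1

instance isFiniteMeasure_lebI : IsFiniteMeasure lebI := by unfold lebI I; infer_instance

theorem perronFrobenius_ae_eq {a b : ℝ} (ha : a ∈ Icc (0 : ℝ) 1) (hb : b ∈ Icc (0 : ℝ) 1)
    {g : ℝ → ℝ} (hg : Integrable g lebI) :
    perronFrobenius lebI (pairedTent a b) g =ᵐ[lebI] tentTransfer a b g := by
  obtain ⟨hi, h⟩ := setIntegral_perronFrobenius (quasiMeasurePreserving_pairedTent ha hb) hg
  refine Integrable.ae_eq_of_forall_setIntegral_eq _ _ hi (integrable_tentTransfer ha hb hg)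
    fun D hD _ => ?_
  have hk := (integral_mul_tentTransfer ha hb hg (k := D.indicator 1)
    (measurable_one.indicator hD) (fun u => by by_cases hu : u ∈ D <;> simp [hu])).2
  rw [h D hD, ← integral_indicator hD, ← integral_indicator (measurable_pairedTent a b hD)]
  have e : ∀ (S : Set ℝ) (φ : ℝ → ℝ), S.indicator φ = fun x => S.indicator 1 x * φ x := by
    intro S φ
    funext x
    by_cases hx : x ∈ S <;> simp [hx]
  rw [e _ g, e D (tentTransfer a b g)]
  exact hk.symm

/-- A genuine equality, since the density depends only on the signed measure. It allows a change of
representative inside a composition. -/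
theorem perronFrobenius_congr {a b : ℝ} {f g : ℝ → ℝ} (h : f =ᵐ[lebI] g) :
    perronFrobenius lebI (pairedTent a b) f = perronFrobenius lebI (pairedTent a b) g := by
  unfold perronFrobenius
  rw [WithDensityᵥEq.congr_ae h]

/-! ### Contraction in `L¹`. -/

theorem abs_fold_le {A : ℝ} (hA : 0 ≤ A) (g : ℝ → ℝ) (u : ℝ) :
    |fold A g u| ≤ fold A (fun t => |g t|) u := by
  unfold fold
  split_ifs
  · rw [abs_mul, abs_of_nonneg (by positivity : 0 ≤ (2 * A)⁻¹)]
    gcongr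
    exact abs_add_le _ _
  · simp

theorem integral_abs_tentTransfer_le {a b : ℝ} (ha : a ∈ Icc (0 : ℝ) 1) (hb : b ∈ Icc (0 : ℝ) 1)
    {g : ℝ → ℝ} (hg : Integrable g lebI) :
    ∫ x, |tentTransfer a b g x| ∂lebI ≤ ∫ x, |g x| ∂lebI := by
  have h := (integral_mul_tentTransfer ha hb hg.abs (k := fun _ => 1) measurable_const (by simp)).2
  simp only [one_mul] at h
  rw [← h]
  refine integral_mono (integrable_tentTransfer ha hb hg).abs
    (integrable_tentTransfer ha hb hg.abs) fun x => ?_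
  exact (abs_add_le _ _).trans (add_le_add (abs_fold_le (by linarith [hb.1]) _ _)
    (abs_fold_le (by linarith [ha.1]) _ _))

/-! ### Total variation under one application of the operator. -/

theorem eVariationOn_add_le {α : Type*} [LinearOrder α] (f g : α → ℝ) (s : Set α) :
    eVariationOn (fun x => f x + g x) s ≤ eVariationOn f s + eVariationOn g s := by
  refine iSup_le fun p => ?_
  calc ∑ i ∈ Finset.range p.1, edist (f (p.2.1 (i + 1)) + g (p.2.1 (i + 1)))
        (f (p.2.1 i) + g (p.2.1 i))
      ≤ ∑ i ∈ Finset.range p.1, (edist (f (p.2.1 (i + 1))) (f (p.2.1 i)) +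
        edist (g (p.2.1 (i + 1))) (g (p.2.1 i))) :=
        Finset.sum_le_sum fun i _ => edist_add_add_le _ _ _ _
    _ ≤ _ := by
        rw [Finset.sum_add_distrib]
        exact add_le_add (eVariationOn.sum_le p.2.2.1 p.2.2.2)
          (eVariationOn.sum_le p.2.2.1 p.2.2.2)

theorem eVariationOn_const_mul_add_le {α : Type*} [LinearOrder α] (c d : ℝ) (f : α → ℝ)
    (s : Set α) :
    eVariationOn (fun x => c * f x + d) s ≤ ENNReal.ofReal |c| * eVariationOn f s := by
  have hl : LipschitzOnWith (Real.toNNReal |c|) (fun y : ℝ => c * y + d) univ := by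
    refine (LipschitzWith.of_dist_le_mul fun x y => ?_).lipschitzOnWith
    rw [Real.coe_toNNReal _ (abs_nonneg c), Real.dist_eq, Real.dist_eq, ← abs_mul]
    apply le_of_eq
    congr 1
    ring
  exact hl.comp_eVariationOn_le (g := f) (mapsTo_univ _ _)

/-- On `[0, A]` the two inverse branches sweep the two quarters of `[-1, 0]`, so together they use
the variation of `g` once. The last term pays for the jump at `A`, where both branches reach `-1/2`.
-/
theorem eVariationOn_fold_le {A : ℝ} (hA : A ∈ Icc (1 : ℝ) 2) (g : ℝ → ℝ) :
    eVariationOn (fold A g) (Icc 0 2) ≤ ENNReal.ofReal (2 * A)⁻¹ *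
      (eVariationOn g (Icc (-1) 0) + ENNReal.ofReal (2 * |g (-1 / 2)|)) := by
  obtain ⟨hA1, hA2⟩ := hA
  set c := (2 * A)⁻¹ with hc
  have hc0 : 0 < c := by positivity
  have hcA : c * A = 1 / 2 := by rw [hc]; field_simp
  have hadd := eVariationOn.Icc_add_Icc (fold A g) (s := univ) (by linarith : (0 : ℝ) ≤ A) hA2
    (mem_univ _)
  simp only [univ_inter] at hadd
  have hadd' := eVariationOn.Icc_add_Icc g (s := univ) (by norm_num : (-1 : ℝ) ≤ -1 / 2)
    (by norm_num : (-1 / 2 : ℝ) ≤ 0) (mem_univ _)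
  simp only [univ_inter] at hadd'
  rw [← hadd, mul_add]
  refine add_le_add ?_ ?_
  · have e : EqOn (fold A g) (fun u => c * (g (c * u + -1) + g (-c * u + 0)) + 0) (Icc 0 A) := by
      intro u hu
      simp [fold, hu.2, hc]
    rw [eVariationOn.congr e]
    refine (eVariationOn_const_mul_add_le c 0 _ _).trans ?_
    rw [abs_of_pos hc0, ← hadd']
    refine mul_le_mul_right ((eVariationOn_add_le _ _ _).trans (add_le_add ?_ ?_)) _
    · refine eVariationOn.comp_le_of_monotoneOn g (fun u => c * u + -1) ?_ ?_
      · intro x _ y _ hxy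
        have := mul_le_mul_of_nonneg_left hxy hc0.le
        simpa using this
      · intro x hx
        have h1 := mul_le_mul_of_nonneg_left hx.1 hc0.le
        have h2 := mul_le_mul_of_nonneg_left hx.2 hc0.le
        constructor <;> linarith
    · refine eVariationOn.comp_le_of_antitoneOn g (fun u => -c * u + 0) ?_ ?_
      · intro x _ y _ hxy
        have := mul_le_mul_of_nonneg_left hxy hc0.le
        simpa using this
      · intro x hx
        have h1 := mul_le_mul_of_nonneg_left hx.1 hc0.le
        have h2 := mul_le_mul_of_nonneg_left hx.2 hc0.le
        constructor <;> linarith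
  -- On `[A, 2]` the fold is an affine image of the unit step `m`, which is monotone. When `A = 2`
  -- the interval is a point and the bound by `1` still holds.
  · set m : ℝ → ℝ := fun u => if u ≤ A then 0 else 1 with hm
    have hmono : MonotoneOn m (Icc A 2) := by
      intro x _ y _ hxy
      simp only [hm]
      split_ifs <;> linarith
    have hmv := hmono.eVariationOn_eq (left_mem_Icc.2 hA2) (right_mem_Icc.2 hA2)
    rw [inter_self] at hmv
    have hmv1 : eVariationOn m (Icc A 2) ≤ 1 := by
      rw [hmv, ENNReal.ofReal_le_one]
      simp only [hm]
      split_ifs <;> norm_num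
    have e : EqOn (fold A g) (fun u => (-(c * (2 * g (-1 / 2)))) * m u + c * (2 * g (-1 / 2)))
        (Icc A 2) := by
      intro u hu
      rcases hu.1.eq_or_lt with h | h
      · subst h
        have e1 : c * A + -1 = -1 / 2 := by rw [hcA]; norm_num
        have e2 : -c * A + 0 = -1 / 2 := by rw [neg_mul, hcA]; norm_num
        simp only [fold, le_refl, if_true, hm, ← hc, e1, e2]
        ring
      · simp [fold, not_le.2 h, hm]
    rw [eVariationOn.congr e]
    refine (eVariationOn_const_mul_add_le _ _ _ _).trans ?_
    rw [abs_neg, abs_mul, abs_mul, abs_of_pos hc0, ENNReal.ofReal_mul hc0.le, abs_two]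
    calc _ ≤ ENNReal.ofReal c * ENNReal.ofReal (2 * |g (-1 / 2)|) * 1 := by gcongr
      _ = _ := mul_one _

theorem eVariationOn_tentTransfer_le {a b : ℝ} (ha : a ∈ Icc (0 : ℝ) 1) (hb : b ∈ Icc (0 : ℝ) 1)
    (g : ℝ → ℝ) :
    eVariationOn (tentTransfer a b g) I ≤
      ENNReal.ofReal (2 * (1 + b))⁻¹ *
        (eVariationOn g (Icc (-1) 0) + ENNReal.ofReal (2 * |g (-1 / 2)|)) +
      ENNReal.ofReal (2 * (1 + a))⁻¹ *
        (eVariationOn (fun t => g (-t)) (Icc (-1) 0) + ENNReal.ofReal (2 * |g (-(-1 / 2))|)) := by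
  refine (eVariationOn_add_le _ _ _).trans (add_le_add ?_ ?_)
  · refine le_trans ?_ (eVariationOn_fold_le ⟨by linarith [hb.1], by linarith [hb.2]⟩ g)
    refine eVariationOn.comp_le_of_monotoneOn (fold (1 + b) g) (fun x => x + 1) ?_ ?_
    · intro x _ y _ hxy
      simpa using hxy
    · intro x hx
      constructor <;> linarith [hx.1, hx.2]
  · refine le_trans ?_ (eVariationOn_fold_le (A := 1 + a)
      ⟨by linarith [ha.1], by linarith [ha.2]⟩ (fun t => g (-t)))
    refine eVariationOn.comp_le_of_antitoneOn (fold (1 + a) (fun t => g (-t)))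
        (fun x => 1 - x) ?_ ?_
    · intro x _ y _ hxy
      exact sub_le_sub_left hxy 1
    · intro x hx
      constructor <;> linarith [hx.1, hx.2]

theorem eVariationOn_comp_neg_le (g : ℝ → ℝ) :
    eVariationOn (fun t => g (-t)) (Icc (-1) 0) ≤ eVariationOn g (Icc 0 1) := by
  refine eVariationOn.comp_le_of_antitoneOn g (fun x => -x) ?_ ?_
  · intro x _ y _ hxy
    exact neg_le_neg hxy
  · intro x hx
    constructor <;> linarith [hx.1, hx.2]

theorem eVariationOn_halves (g : ℝ → ℝ) :
    eVariationOn g (Icc (-1) 0) + eVariationOn g (Icc 0 1) = eVariationOn g I := by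
  have := eVariationOn.Icc_add_Icc g (s := univ) (by norm_num : (-1 : ℝ) ≤ 0)
    (by norm_num : (0 : ℝ) ≤ 1) (mem_univ _)
  simp only [univ_inter] at this
  exact this

theorem toReal_eVariationOn_halves_le {g : ℝ → ℝ} (hg : BoundedVariationOn g I) :
    BoundedVariationOn g (Icc (-1) 0) ∧ BoundedVariationOn (fun t => g (-t)) (Icc (-1) 0) ∧
    (eVariationOn g (Icc (-1) 0)).toReal + (eVariationOn (fun t => g (-t)) (Icc (-1) 0)).toReal ≤
      (eVariationOn g I).toReal := by
  have hl : eVariationOn g (Icc (-1) 0) ≠ ∞ := hg.mono (Icc_subset_Icc le_rfl (by norm_num))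
  have hr : eVariationOn g (Icc 0 1) ≠ ∞ := hg.mono (Icc_subset_Icc (by norm_num) le_rfl)
  have hn := ne_top_of_le_ne_top hr (eVariationOn_comp_neg_le g)
  refine ⟨hl, hn, ?_⟩
  rw [← eVariationOn_halves, ENNReal.toReal_add hl hr]
  gcongr
  exact eVariationOn_comp_neg_le g

/-- Real-valued form of `eVariationOn_tentTransfer_le`. -/
theorem variation_tentTransfer_le {a b : ℝ} (ha : a ∈ Icc (0 : ℝ) 1) (hb : b ∈ Icc (0 : ℝ) 1)
    {g : ℝ → ℝ} (hg : BoundedVariationOn g I) :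
    BoundedVariationOn (tentTransfer a b g) I ∧
    (eVariationOn (tentTransfer a b g) I).toReal ≤
      (2 * (1 + b))⁻¹ * ((eVariationOn g (Icc (-1) 0)).toReal + 2 * |g (-1 / 2)|) +
      (2 * (1 + a))⁻¹ * ((eVariationOn (fun t => g (-t)) (Icc (-1) 0)).toReal +
        2 * |g (-(-1 / 2))|) := by
  obtain ⟨hl, hr, -⟩ := toReal_eVariationOn_halves_le hg
  have h := eVariationOn_tentTransfer_le ha hb g
  have hb0 : 0 ≤ (2 * (1 + b))⁻¹ := by have := hb.1; positivity
  have ha0 : 0 ≤ (2 * (1 + a))⁻¹ := by have := ha.1; positivity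
  rw [← ENNReal.ofReal_toReal hl, ← ENNReal.ofReal_toReal hr,
    ← ENNReal.ofReal_add (by positivity) (by positivity),
    ← ENNReal.ofReal_add (by positivity) (by positivity),
    ← ENNReal.ofReal_mul hb0, ← ENNReal.ofReal_mul ha0,
    ← ENNReal.ofReal_add (by positivity) (by positivity)] at h
  exact ⟨ne_top_of_le_ne_top ENNReal.ofReal_ne_top h,
    ENNReal.toReal_le_of_le_ofReal (by positivity) h⟩

/-! ### Point values bounded by variation and integral. -/

theorem exists_abs_mul_le_integral {h : ℝ → ℝ} {p q : ℝ} (hpq : p < q)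
    (hh : IntervalIntegrable h volume p q) :
    ∃ c ∈ Icc p q, (q - p) * |h c| ≤ ∫ t in p..q, |h t| := by
  have hi : IntegrableOn (fun t => |h t|) (Icc p q) :=
    ((intervalIntegrable_iff_integrableOn_Icc_of_le hpq.le).1 hh).abs
  obtain ⟨c, hc, hle⟩ := exists_le_setAverage (μ := volume) (s := Icc p q)
    (by simpa using hpq) (by simp) hi
  refine ⟨c, hc, ?_⟩
  rw [setAverage_eq, integral_Icc_eq_integral_Ioc, ← intervalIntegral.integral_of_le hpq.le,
    Real.volume_real_Icc_of_le hpq.le, smul_eq_mul, le_inv_mul_iff₀ (by linarith)] at hle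
  exact hle

theorem abs_le_abs_add_variation {h : ℝ → ℝ} {s : Set ℝ} (hh : BoundedVariationOn h s) {x y : ℝ}
    (hx : x ∈ s) (hy : y ∈ s) : |h x| ≤ |h y| + (eVariationOn h s).toReal := by
  have h1 := hh.dist_le hx hy
  rw [Real.dist_eq] at h1
  have h2 := abs_sub_abs_le_abs_sub (h x) (h y)
  linarith

theorem toReal_eVariationOn_Icc_add {h : ℝ → ℝ} {p q r : ℝ} (hh : BoundedVariationOn h (Icc p r))
    (hpq : p ≤ q) (hqr : q ≤ r) :
    (eVariationOn h (Icc p q)).toReal + (eVariationOn h (Icc q r)).toReal =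
      (eVariationOn h (Icc p r)).toReal := by
  have := eVariationOn.Icc_add_Icc h (s := univ) hpq hqr (mem_univ _)
  simp only [univ_inter] at this
  rw [← this, ENNReal.toReal_add (hh.mono (Icc_subset_Icc le_rfl hqr))
    (hh.mono (Icc_subset_Icc hpq le_rfl))]

/-- The two endpoints are compared with `c` along disjoint pieces, so the variation is spent once
rather than twice. -/
theorem abs_endpoints_le {h : ℝ → ℝ} {p c q : ℝ} (hh : BoundedVariationOn h (Icc p q))
    (hc : c ∈ Icc p q) : |h p| + |h q| ≤ 2 * |h c| + (eVariationOn h (Icc p q)).toReal := by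
  have h1 := abs_le_abs_add_variation (hh.mono (Icc_subset_Icc le_rfl hc.2))
    (left_mem_Icc.2 hc.1) (right_mem_Icc.2 hc.1)
  have h2 := abs_le_abs_add_variation (hh.mono (Icc_subset_Icc hc.1 le_rfl))
    (right_mem_Icc.2 hc.2) (left_mem_Icc.2 hc.2)
  linarith [toReal_eVariationOn_Icc_add hh hc.1 hc.2]

theorem abs_half_le {h : ℝ → ℝ} (hh : BoundedVariationOn h (Icc 0 (1 / 2)))
    (hi : IntervalIntegrable h volume 0 (1 / 2)) :
    |h (1 / 2)| ≤ (eVariationOn h (Icc 0 (1 / 2))).toReal + 2 * ∫ t in (0 : ℝ)..1 / 2, |h t| := by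
  obtain ⟨c, hc, hle⟩ := exists_abs_mul_le_integral (by norm_num) hi
  have := abs_le_abs_add_variation hh (right_mem_Icc.2 (by norm_num)) hc
  linarith

/-- Here `h` is `g` on a quarter of `I`, with `1/2` at the peak and `(4A)⁻¹`, `3(4A)⁻¹` the
preimages of the heights `1/2`, `3/2`; the latter is attained only if `A ≥ 3/2`. The interval is cut
at `z = (4A)⁻¹`. One copy of `|h z|` is charged to `[0, z]`, the other, paired with `|h (1/2)|`, to
`[z, 1/2]`. The variation coefficients are then at most `1`, or `3` when `A ≥ 3/2`, hence below `3A
- 1`. -/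
theorem sum_abs_jumps_le {A : ℝ} (hA : A ∈ Icc (1 : ℝ) 2) {h : ℝ → ℝ}
    (hh : BoundedVariationOn h (Icc 0 (1 / 2))) (hi : IntervalIntegrable h volume 0 (1 / 2)) :
    |h (1 / 2)| + 2 * |h ((4 * A)⁻¹)| + (if 3 / 2 ≤ A then 2 * |h (3 * (4 * A)⁻¹)| else 0) ≤
      (3 * A - 1) * (eVariationOn h (Icc 0 (1 / 2))).toReal +
        13 * A * ∫ t in (0 : ℝ)..1 / 2, |h t| := by
  obtain ⟨hA1, hA2⟩ := hA
  set z := (4 * A)⁻¹ with hz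
  have hz0 : 0 < z := by positivity
  have hzA : z * A = 1 / 4 := by rw [hz]; field_simp
  have hz1 : z ≤ 1 / 4 := by nlinarith
  have i₁ : IntervalIntegrable h volume 0 z := hi.mono_set (by
    rw [uIcc_of_le hz0.le, uIcc_of_le (by norm_num)]
    exact Icc_subset_Icc le_rfl (by linarith))
  have i₂ : IntervalIntegrable h volume z (1 / 2) := hi.mono_set (by
    rw [uIcc_of_le (by linarith), uIcc_of_le (by norm_num)]
    exact Icc_subset_Icc hz0.le le_rfl)
  have v₁ : BoundedVariationOn h (Icc 0 z) := hh.mono (Icc_subset_Icc le_rfl (by linarith))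
  have v₂ : BoundedVariationOn h (Icc z (1 / 2)) := hh.mono (Icc_subset_Icc hz0.le le_rfl)
  obtain ⟨c₁, hc₁, le₁⟩ := exists_abs_mul_le_integral hz0 i₁
  obtain ⟨c₂, hc₂, le₂⟩ := exists_abs_mul_le_integral (by linarith) i₂
  have hV := toReal_eVariationOn_Icc_add hh hz0.le (by linarith : z ≤ 1 / 2)
  have hJ := intervalIntegral.integral_add_adjacent_intervals i₁.abs i₂.abs
  have n₁ : 0 ≤ ∫ t in (0 : ℝ)..z, |h t| :=
    intervalIntegral.integral_nonneg hz0.le fun _ _ => abs_nonneg _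
  have n₂ : 0 ≤ ∫ t in z..(1 / 2), |h t| :=
    intervalIntegral.integral_nonneg (by linarith) fun _ _ => abs_nonneg _
  have m₁ := abs_le_abs_add_variation v₁ (right_mem_Icc.2 hz0.le) hc₁
  have m₂ := abs_endpoints_le v₂ hc₂
  rw [← hV, ← hJ]
  set V₁ := (eVariationOn h (Icc 0 z)).toReal
  set V₂ := (eVariationOn h (Icc z (1 / 2))).toReal
  set J₁ := ∫ t in (0 : ℝ)..z, |h t|
  set J₂ := ∫ t in z..(1 / 2), |h t|
  have p₁ : 0 ≤ V₁ := ENNReal.toReal_nonneg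
  have p₂ : 0 ≤ V₂ := ENNReal.toReal_nonneg
  have b₁ : |h c₁| ≤ 4 * A * J₁ := by
    have := mul_le_mul_of_nonneg_left le₁ (by positivity : 0 ≤ 4 * A)
    have e : 4 * A * ((z - 0) * |h c₁|) = |h c₁| := by linear_combination 4 * |h c₁| * hzA
    linarith
  have b₂ : (2 * A - 1) * |h c₂| ≤ 4 * A * J₂ := by
    have := mul_le_mul_of_nonneg_left le₂ (by positivity : 0 ≤ 4 * A)
    have e : 4 * A * ((1 / 2 - z) * |h c₂|) = (2 * A - 1) * |h c₂| := by
      linear_combination -4 * |h c₂| * hzA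
    linarith
  have a₂ := abs_nonneg (h c₂)
  have q₁ : 0 ≤ (A - 1) * V₁ := mul_nonneg (by linarith) p₁
  have q₂ : 0 ≤ (A - 1) * V₂ := mul_nonneg (by linarith) p₂
  have r₁ : 0 ≤ A * J₁ := mul_nonneg (by linarith) n₁
  have r₂ : 0 ≤ A * J₂ := mul_nonneg (by linarith) n₂
  split_ifs with h32
  -- The second preimage lies in the quarter exactly because `A ≥ 3/2`.
  · have hy : 3 * z ∈ Icc z (1 / 2) := ⟨by linarith, by nlinarith⟩
    have m₃ := abs_le_abs_add_variation v₂ hy hc₂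
    have q₁ : 0 ≤ (A - 3 / 2) * V₁ := mul_nonneg (by linarith) p₁
    have q₂ : 0 ≤ (A - 3 / 2) * V₂ := mul_nonneg (by linarith) p₂
    have : 0 ≤ (2 * A - 3) * |h c₂| := mul_nonneg (by linarith) a₂
    linarith
  · have : 0 ≤ (2 * A - 2) * |h c₂| := mul_nonneg (by linarith) a₂
    linarith

theorem intervalIntegral_abs_quarters {g : ℝ → ℝ} (hi : IntervalIntegrable g volume (-1) 0) :
    IntervalIntegrable (fun t => g (t + -1)) volume 0 (1 / 2) ∧
    IntervalIntegrable (fun t => g (-t)) volume 0 (1 / 2) ∧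
    (∫ t in (0 : ℝ)..1 / 2, |g (t + -1)|) + ∫ t in (0 : ℝ)..1 / 2, |g (-t)| =
      ∫ t in (-1 : ℝ)..0, |g t| := by
  have hl : IntervalIntegrable g volume (-1) (-(1 / 2)) :=
    hi.mono_set (by rw [uIcc_of_le (by norm_num), uIcc_of_le (by norm_num)]
                    exact Icc_subset_Icc le_rfl (by norm_num))
  have hr : IntervalIntegrable g volume (-(1 / 2)) 0 :=
    hi.mono_set (by rw [uIcc_of_le (by norm_num), uIcc_of_le (by norm_num)]
                    exact Icc_subset_Icc (by norm_num) le_rfl)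
  refine ⟨?_, ?_, ?_⟩
  · have := intervalIntegrable_comp_affine (h := g) (c := 1) (d := -1) (p := 0) (q := 1 / 2)
      (by norm_num) (by convert hl using 1 <;> norm_num)
    simpa using this
  · have := intervalIntegrable_comp_affine (h := g) (c := -1) (d := 0) (p := 0) (q := 1 / 2)
      (by norm_num) (by convert hr.symm using 1 <;> norm_num)
    simpa using this
  · rw [intervalIntegral.integral_comp_add_right (fun t => |g t|),
      intervalIntegral.integral_comp_neg (fun t => |g t|),
      ← intervalIntegral.integral_add_adjacent_intervals hl.abs hr.abs]
    norm_num

theorem variation_quarters {g : ℝ → ℝ} (hg : BoundedVariationOn g (Icc (-1) 0)) :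
    BoundedVariationOn (fun t => g (t + -1)) (Icc 0 (1 / 2)) ∧
    BoundedVariationOn (fun t => g (-t)) (Icc 0 (1 / 2)) ∧
    (eVariationOn (fun t => g (t + -1)) (Icc 0 (1 / 2))).toReal +
      (eVariationOn (fun t => g (-t)) (Icc 0 (1 / 2))).toReal ≤
      (eVariationOn g (Icc (-1) 0)).toReal := by
  have hl : BoundedVariationOn g (Icc (-1) (-1 / 2)) :=
    hg.mono (Icc_subset_Icc le_rfl (by norm_num))
  have hr : BoundedVariationOn g (Icc (-1 / 2) 0) := hg.mono (Icc_subset_Icc (by norm_num) le_rfl)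
  have h1 : eVariationOn (fun t => g (t + -1)) (Icc 0 (1 / 2)) ≤
      eVariationOn g (Icc (-1) (-1 / 2)) := by
    refine eVariationOn.comp_le_of_monotoneOn g (fun t => t + -1) ?_ ?_
    · intro x _ y _ hxy
      simpa using hxy
    · intro x hx
      constructor <;> linarith [hx.1, hx.2]
  have h2 : eVariationOn (fun t => g (-t)) (Icc 0 (1 / 2)) ≤ eVariationOn g (Icc (-1 / 2) 0) := by
    refine eVariationOn.comp_le_of_antitoneOn g (fun t => -t) ?_ ?_
    · intro x _ y _ hxy
      exact neg_le_neg hxy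
    · intro x hx
      constructor <;> linarith [hx.1, hx.2]
  refine ⟨ne_top_of_le_ne_top hl h1, ne_top_of_le_ne_top hr h2, ?_⟩
  rw [← toReal_eVariationOn_Icc_add hg (by norm_num : (-1 : ℝ) ≤ -1 / 2) (by norm_num)]
  gcongr

theorem two_mul_abs_mid_le {g : ℝ → ℝ} (hg : BoundedVariationOn g (Icc (-1) 0))
    (hi : IntervalIntegrable g volume (-1) 0) :
    2 * |g (-1 / 2)| ≤ (eVariationOn g (Icc (-1) 0)).toReal + 2 * ∫ t in (-1 : ℝ)..0, |g t| := by
  obtain ⟨i₁, i₂, hJ⟩ := intervalIntegral_abs_quarters hi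
  obtain ⟨v₁, v₂, hV⟩ := variation_quarters hg
  have h₁ := abs_half_le v₁ i₁
  have h₂ := abs_half_le v₂ i₂
  norm_num at h₁ h₂ hV hJ ⊢
  linarith

/-- With `z = (4A)⁻¹`, the left side is at most `z` times `V` plus the sums in `sum_abs_jumps_le`
over both quarters. The resulting coefficient `z * (1 + (3A - 1)) = 3 * z * A = 3/4` does not depend
on `A`, and likewise `13 * A * z = 13/4`. -/
theorem two_step_half_le {A : ℝ} (hA : A ∈ Icc (1 : ℝ) 2) {g : ℝ → ℝ}
    (hg : BoundedVariationOn g (Icc (-1) 0)) (hi : IntervalIntegrable g volume (-1) 0) :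
    1 / 2 * ((2 * A)⁻¹ * ((eVariationOn g (Icc (-1) 0)).toReal + 2 * |g (-1 / 2)|)) +
      |fold A g (1 / 2)| + |fold A g (3 / 2)| ≤
      3 / 4 * (eVariationOn g (Icc (-1) 0)).toReal + 13 / 4 * ∫ t in (-1 : ℝ)..0, |g t| := by
  obtain ⟨i₁, i₂, hJ⟩ := intervalIntegral_abs_quarters hi
  obtain ⟨v₁, v₂, hV⟩ := variation_quarters hg
  have h₁ := sum_abs_jumps_le hA v₁ i₁
  have h₂ := sum_abs_jumps_le hA v₂ i₂
  obtain ⟨hA1, hA2⟩ := hA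
  have hz : (2 * A)⁻¹ = 2 * (4 * A)⁻¹ := by field_simp; norm_num
  have hz0 : 0 < (4 * A)⁻¹ := by positivity
  have hzA : (4 * A)⁻¹ * A = 1 / 4 := by field_simp
  set z := (4 * A)⁻¹
  have f₁ : |fold A g (1 / 2)| ≤ 2 * z * (|g (z + -1)| + |g (-z)|) := by
    have e1 : 2 * z * (1 / 2) + -1 = z + -1 := by ring
    have e2 : -(2 * z) * (1 / 2) + 0 = -z := by ring
    rw [fold, if_pos (by linarith), hz, e1, e2, abs_mul, abs_of_pos (by positivity)]
    gcongr
    exact abs_add_le _ _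
  have f₂ : |fold A g (3 / 2)| ≤ z * ((if 3 / 2 ≤ A then 2 * |g (3 * z + -1)| else 0) +
      (if 3 / 2 ≤ A then 2 * |g (-(3 * z))| else 0)) := by
    have e1 : 2 * z * (3 / 2) + -1 = 3 * z + -1 := by ring
    have e2 : -(2 * z) * (3 / 2) + 0 = -(3 * z) := by ring
    unfold fold
    split_ifs
    · rw [hz, e1, e2, abs_mul, abs_of_pos (by positivity)]
      have := mul_le_mul_of_nonneg_left (abs_add_le (g (3 * z + -1)) (g (-(3 * z)))) hz0.le
      linarith
    · simp
  have e3 : (1 / 2 + -1 : ℝ) = -1 / 2 := by norm_num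
  have e4 : (-(1 / 2) : ℝ) = -1 / 2 := by norm_num
  simp only [e3, e4] at h₁ h₂
  rw [hz]
  have hsum := mul_le_mul_of_nonneg_left (add_le_add h₁ h₂) hz0.le
  have hVA := mul_le_mul_of_nonneg_left hV (by linarith : 0 ≤ 3 * A - 1)
  have hVA' := mul_le_mul_of_nonneg_left hVA hz0.le
  rw [← hJ]
  set V := (eVariationOn g (Icc (-1) 0)).toReal
  set V₁ := (eVariationOn (fun t => g (t + -1)) (Icc 0 (1 / 2))).toReal
  set V₂ := (eVariationOn (fun t => g (-t)) (Icc 0 (1 / 2))).toReal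
  set J₁ := ∫ t in (0 : ℝ)..1 / 2, |g (t + -1)|
  set J₂ := ∫ t in (0 : ℝ)..1 / 2, |g (-t)|
  have k₁ : z * ((3 * A - 1) * V) = 3 / 4 * V - z * V := by linear_combination 3 * V * hzA
  have k₂ : z * (13 * A * J₁ + 13 * A * J₂) = 13 / 4 * (J₁ + J₂) := by
    linear_combination 13 * (J₁ + J₂) * hzA
  linarith

theorem integral_abs_halves {g : ℝ → ℝ} (hg : Integrable g lebI) :
    IntervalIntegrable g volume (-1) 0 ∧ IntervalIntegrable (fun t => g (-t)) volume (-1) 0 ∧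
    (∫ t in (-1 : ℝ)..0, |g t|) + ∫ t in (-1 : ℝ)..0, |g (-t)| = ∫ t, |g t| ∂lebI := by
  rw [integral_lebI]
  rw [integrable_lebI_iff] at hg
  have hl : IntervalIntegrable g volume (-1) 0 :=
    hg.mono_set (by rw [uIcc_of_le (by norm_num), uIcc_of_le (by norm_num)]
                    exact Icc_subset_Icc le_rfl (by norm_num))
  have hr : IntervalIntegrable g volume 0 1 :=
    hg.mono_set (by rw [uIcc_of_le (by norm_num), uIcc_of_le (by norm_num)]
                    exact Icc_subset_Icc (by norm_num) le_rfl)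
  refine ⟨hl, ?_, ?_⟩
  · have := intervalIntegrable_comp_affine (h := g) (c := -1) (d := 0) (p := -1) (q := 0)
      (by norm_num) (by simpa using hr.symm)
    simpa using this
  · rw [intervalIntegral.integral_comp_neg (fun t => |g t|),
      ← intervalIntegral.integral_add_adjacent_intervals hl.abs hr.abs]
    norm_num

/-! ### One-step and two-step inequalities for a fixed representative. -/

theorem inv_two_mul_le {A : ℝ} (hA : 1 ≤ A) : (2 * A)⁻¹ ≤ 1 / 2 := by
  rw [one_div]
  gcongr
  linarith

theorem variation_one_step_le {a b : ℝ} (ha : a ∈ Icc (0 : ℝ) 1) (hb : b ∈ Icc (0 : ℝ) 1)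
    {g : ℝ → ℝ} (hg : BoundedVariationOn g I) (hi : Integrable g lebI) :
    (eVariationOn (tentTransfer a b g) I).toReal ≤
      (eVariationOn g I).toReal + ∫ t, |g t| ∂lebI := by
  obtain ⟨v₁, v₂, hV⟩ := toReal_eVariationOn_halves_le hg
  obtain ⟨i₁, i₂, hJ⟩ := integral_abs_halves hi
  have h := (variation_tentTransfer_le ha hb hg).2
  have h₁ := two_mul_abs_mid_le v₁ i₁
  have h₂ := two_mul_abs_mid_le v₂ i₂
  have k₁ := mul_le_mul_of_nonneg_right (inv_two_mul_le (by linarith [hb.1] : 1 ≤ 1 + b))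
    (by positivity : 0 ≤ (eVariationOn g (Icc (-1) 0)).toReal + 2 * |g (-1 / 2)|)
  have k₂ := mul_le_mul_of_nonneg_right (inv_two_mul_le (by linarith [ha.1] : 1 ≤ 1 + a))
    (by positivity : 0 ≤ (eVariationOn (fun t => g (-t)) (Icc (-1) 0)).toReal +
      2 * |g (-(-1 / 2))|)
  linarith

theorem variation_two_step_le {a b a' b' : ℝ} (ha : a ∈ Icc (0 : ℝ) 1) (hb : b ∈ Icc (0 : ℝ) 1)
    (ha' : a' ∈ Icc (0 : ℝ) 1) (hb' : b' ∈ Icc (0 : ℝ) 1)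
    {g : ℝ → ℝ} (hg : BoundedVariationOn g I) (hi : Integrable g lebI) :
    (eVariationOn (tentTransfer a' b' (tentTransfer a b g)) I).toReal ≤
      3 / 4 * (eVariationOn g I).toReal + 13 / 4 * ∫ t, |g t| ∂lebI := by
  obtain ⟨v₁, v₂, hV⟩ := toReal_eVariationOn_halves_le hg
  obtain ⟨i₁, i₂, hJ⟩ := integral_abs_halves hi
  obtain ⟨hG, hGV⟩ := variation_tentTransfer_le ha hb hg
  obtain ⟨-, -, hV'⟩ := toReal_eVariationOn_halves_le hG
  have h := (variation_tentTransfer_le ha' hb' hG).2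
  have h₁ := two_step_half_le (A := 1 + b) ⟨by linarith [hb.1], by linarith [hb.2]⟩ v₁ i₁
  have h₂ := two_step_half_le (A := 1 + a) ⟨by linarith [ha.1], by linarith [ha.2]⟩ v₂ i₂
  -- The point `-1/2` has height `1/2` for the left fold and `3/2` for the right one; at `1/2` the
  -- roles are exchanged. Regrouping by fold decouples the halves.
  have e₁ : |tentTransfer a b g (-1 / 2)| ≤
      |fold (1 + b) g (1 / 2)| + |fold (1 + a) (fun t => g (-t)) (3 / 2)| := by
    refine (abs_add_le _ _).trans_eq ?_
    norm_num
  have e₂ : |tentTransfer a b g (-(-1 / 2))| ≤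
      |fold (1 + b) g (3 / 2)| + |fold (1 + a) (fun t => g (-t)) (1 / 2)| := by
    refine (abs_add_le _ _).trans_eq ?_
    norm_num
  set G := tentTransfer a b g
  have k₁ := mul_le_mul_of_nonneg_right (inv_two_mul_le (by linarith [hb'.1] : 1 ≤ 1 + b'))
    (by positivity : 0 ≤ (eVariationOn G (Icc (-1) 0)).toReal + 2 * |G (-1 / 2)|)
  have k₂ := mul_le_mul_of_nonneg_right (inv_two_mul_le (by linarith [ha'.1] : 1 ≤ 1 + a'))
    (by positivity : 0 ≤ (eVariationOn (fun t => G (-t)) (Icc (-1) 0)).toReal +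
      2 * |G (-(-1 / 2))|)
  linarith

/-! ### Passage from representatives to classes. -/

/-- Representatives of infinite variation are harmless because `c ≠ 0` makes the right side
infinite. -/
theorem le_mul_Var_add {F c K : ℝ≥0∞} (hc : c ≠ 0) (hc' : c ≠ ∞) {f : ℝ → ℝ}
    (h : ∀ g, g =ᵐ[lebI] f → BoundedVariationOn g I → F ≤ c * eVariationOn g I + K) :
    F ≤ c * Var f + K := by
  have h' : ∀ g, g =ᵐ[lebI] f → F ≤ c * eVariationOn g I + K := by
    intro g hg
    by_cases hv : eVariationOn g I = ∞
    · simp [hv, ENNReal.mul_top hc]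
    · exact h g hg hv
  unfold Var
  simp only [ENNReal.mul_iInf_of_ne hc hc', ENNReal.iInf_add]
  exact le_iInf₂ h'

theorem Var_le_of_ae_eq {f g : ℝ → ℝ} (h : g =ᵐ[lebI] f) : Var f ≤ eVariationOn g I :=
  iInf₂_le g h

theorem ofReal_integral_abs {f : ℝ → ℝ} (hf : Integrable f lebI) :
    ENNReal.ofReal (∫ x, |f x| ∂lebI) = eLpNorm f 1 lebI := by
  rw [eLpNorm_one_eq_lintegral_enorm, ← ofReal_integral_norm_eq_lintegral_enorm hf]
  rfl

theorem eVariationOn_le_of_toReal_le {F g f : ℝ → ℝ} {c K : ℝ} (hc : 0 ≤ c) (hK : 0 ≤ K)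
    (hF : BoundedVariationOn F I) (hg : BoundedVariationOn g I) (hi : Integrable g lebI)
    (hgf : g =ᵐ[lebI] f)
    (h : (eVariationOn F I).toReal ≤ c * (eVariationOn g I).toReal + K * ∫ x, |g x| ∂lebI) :
    eVariationOn F I ≤
      ENNReal.ofReal c * eVariationOn g I + ENNReal.ofReal K * eLpNorm f 1 lebI := by
  have hJ : 0 ≤ ∫ x, |g x| ∂lebI := integral_nonneg fun x => abs_nonneg _
  rw [← eLpNorm_congr_ae hgf, ← ofReal_integral_abs hi, ← ENNReal.ofReal_toReal hg,
    ← ENNReal.ofReal_toReal hF, ← ENNReal.ofReal_mul hc, ← ENNReal.ofReal_mul hK,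
    ← ENNReal.ofReal_add (by positivity) (by positivity)]
  exact ENNReal.ofReal_le_ofReal h

theorem Var_perronFrobenius_le {a b : ℝ} (ha : a ∈ Icc (0 : ℝ) 1) (hb : b ∈ Icc (0 : ℝ) 1)
    {f : ℝ → ℝ} (hf : Integrable f lebI) :
    Var (perronFrobenius lebI (pairedTent a b) f) ≤ Var f + eLpNorm f 1 lebI := by
  have key := le_mul_Var_add (c := ENNReal.ofReal 1) (K := ENNReal.ofReal 1 * eLpNorm f 1 lebI)
    (f := f) (F := Var (perronFrobenius lebI (pairedTent a b) f)) (by simp) (by simp) ?_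
  · simpa using key
  intro g hgf hg
  have hi : Integrable g lebI := hf.congr hgf.symm
  rw [← perronFrobenius_congr hgf]
  refine (Var_le_of_ae_eq (perronFrobenius_ae_eq ha hb hi).symm).trans ?_
  refine eVariationOn_le_of_toReal_le zero_le_one zero_le_one (variation_tentTransfer_le ha hb hg).1
    hg hi hgf ?_
  simpa using variation_one_step_le ha hb hg hi

theorem Var_perronFrobenius_two_step_le {a b a' b' : ℝ} (ha : a ∈ Icc (0 : ℝ) 1)
    (hb : b ∈ Icc (0 : ℝ) 1) (ha' : a' ∈ Icc (0 : ℝ) 1) (hb' : b' ∈ Icc (0 : ℝ) 1)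
    {f : ℝ → ℝ} (hf : Integrable f lebI) :
    Var (perronFrobenius lebI (pairedTent a' b') (perronFrobenius lebI (pairedTent a b) f)) ≤
      ENNReal.ofReal (3 / 4) * Var f + ENNReal.ofReal (13 / 4) * eLpNorm f 1 lebI := by
  refine le_mul_Var_add (by simp) (by simp) fun g hgf hg => ?_
  have hi : Integrable g lebI := hf.congr hgf.symm
  rw [← perronFrobenius_congr hgf, perronFrobenius_congr (perronFrobenius_ae_eq ha hb hi)]
  refine (Var_le_of_ae_eq (perronFrobenius_ae_eq ha' hb'
    (integrable_tentTransfer ha hb hi)).symm).trans ?_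
  exact eVariationOn_le_of_toReal_le (by norm_num) (by norm_num)
    (variation_tentTransfer_le ha' hb' (variation_tentTransfer_le ha hb hg).1).1 hg hi hgf
    (variation_two_step_le ha hb ha' hb' hg hi)

theorem eLpNorm_perronFrobenius_le {a b : ℝ} (ha : a ∈ Icc (0 : ℝ) 1) (hb : b ∈ Icc (0 : ℝ) 1)
    {f : ℝ → ℝ} (hf : Integrable f lebI) :
    eLpNorm (perronFrobenius lebI (pairedTent a b) f) 1 lebI ≤ eLpNorm f 1 lebI := by
  rw [eLpNorm_congr_ae (perronFrobenius_ae_eq ha hb hf),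
    ← ofReal_integral_abs (integrable_tentTransfer ha hb hf), ← ofReal_integral_abs hf]
  exact ENNReal.ofReal_le_ofReal (integral_abs_tentTransfer_le ha hb hf)

/-! ### Iteration along the cocycle. -/

section Cocycle

variable {Ω : Type*} {σ : Ω → Ω} {a b : Ω → ℝ} {ε : ℝ}

theorem Admissible.mem_Icc (hε : Admissible a b ε) (ha : ∀ ω, a ω ∈ Icc (0 : ℝ) 1)
    (hb : ∀ ω, b ω ∈ Icc (0 : ℝ) 1) (ω : Ω) :
    ε * a ω ∈ Icc (0 : ℝ) 1 ∧ ε * b ω ∈ Icc (0 : ℝ) 1 :=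
  ⟨⟨mul_nonneg hε.1 (ha ω).1, (hε.2 ω).1⟩, ⟨mul_nonneg hε.1 (hb ω).1, (hε.2 ω).2⟩⟩

theorem integrable_cocycle (ω : Ω) {f : ℝ → ℝ} (hf : Integrable f lebI) :
    ∀ n, Integrable (cocycle σ (tentOp a b ε) n ω f) lebI
  | 0 => hf
  | _ + 1 => SignedMeasure.integrable_rnDeriv _ _

theorem eLpNorm_cocycle_le (hε : Admissible a b ε) (ha : ∀ ω, a ω ∈ Icc (0 : ℝ) 1)
    (hb : ∀ ω, b ω ∈ Icc (0 : ℝ) 1) (ω : Ω) {f : ℝ → ℝ} (hf : Integrable f lebI) (n : ℕ) :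
    eLpNorm (cocycle σ (tentOp a b ε) n ω f) 1 lebI ≤ eLpNorm f 1 lebI := by
  induction n with
  | zero => exact le_rfl
  | succ n ih =>
    obtain ⟨h₁, h₂⟩ := hε.mem_Icc ha hb (σ^[n] ω)
    exact (eLpNorm_perronFrobenius_le h₁ h₂ (integrable_cocycle ω hf n)).trans ih

/-- The last two factors are peeled off together. The one-step bound is needed only for `n = 1`, the
start of the odd chain. -/
theorem Var_cocycle_le (hε : Admissible a b ε) (ha : ∀ ω, a ω ∈ Icc (0 : ℝ) 1)
    (hb : ∀ ω, b ω ∈ Icc (0 : ℝ) 1) (ω : Ω) {f : ℝ → ℝ} (hf : Integrable f lebI) (n : ℕ) :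
    Var (cocycle σ (tentOp a b ε) n ω f) ≤
      (3 / 4 : ℝ≥0∞) ^ (n / 2) * Var f + 13 * eLpNorm f 1 lebI := by
  have h34 : ENNReal.ofReal (3 / 4) = 3 / 4 := by
    rw [ENNReal.ofReal_div_of_pos (by norm_num)]
    simp
  induction n using Nat.twoStepInduction with
  | zero => simp [cocycle]
  | one =>
    obtain ⟨h₁, h₂⟩ := hε.mem_Icc ha hb ω
    refine (Var_perronFrobenius_le h₁ h₂ hf).trans ?_
    simp only [Nat.reduceDiv, pow_zero, one_mul]
    gcongr
    exact le_mul_of_one_le_left (zero_le) (by norm_num)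
  | more n ih _ =>
    obtain ⟨h₁, h₂⟩ := hε.mem_Icc ha hb (σ^[n] ω)
    obtain ⟨h₁', h₂'⟩ := hε.mem_Icc ha hb (σ^[n + 1] ω)
    refine (Var_perronFrobenius_two_step_le h₁ h₂ h₁' h₂' (integrable_cocycle ω hf n)).trans ?_
    have hN := eLpNorm_cocycle_le (σ := σ) hε ha hb ω hf n
    have e13 : ENNReal.ofReal (3 / 4) * 13 + ENNReal.ofReal (13 / 4) = 13 := by
      rw [show (13 : ℝ≥0∞) = ENNReal.ofReal 13 by simp, ← ENNReal.ofReal_mul (by norm_num),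
        ← ENNReal.ofReal_add (by norm_num) (by norm_num)]
      norm_num
    calc _ ≤ ENNReal.ofReal (3 / 4) *
          ((3 / 4 : ℝ≥0∞) ^ (n / 2) * Var f + 13 * eLpNorm f 1 lebI) +
          ENNReal.ofReal (13 / 4) * eLpNorm f 1 lebI := by gcongr
      _ = (3 / 4 : ℝ≥0∞) ^ (n / 2 + 1) * Var f +
          (ENNReal.ofReal (3 / 4) * 13 + ENNReal.ofReal (13 / 4)) * eLpNorm f 1 lebI := by
        rw [pow_succ, h34]; ring
      _ = _ := by rw [e13, Nat.add_div_right n (by norm_num)]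

end Cocycle

theorem eLpNorm_normLebI (f : ℝ → ℝ) :
    26 * eLpNorm f 1 normLebI = 13 * eLpNorm f 1 lebI := by
  rw [normLebI, eLpNorm_one_smul_measure, ← mul_assoc]
  congr 1
  rw [show (26 : ℝ≥0∞) = 13 * 2 by norm_num, mul_assoc,
    ENNReal.mul_inv_cancel (by norm_num) (by norm_num), mul_one]

/-- The rate comes from `3/4 ≤ (7/8)^2 = 49/64`; the factor `2` absorbs the unpaired step of an odd
`n`, as `2 * (7/8) ≥ 1`. -/
theorem three_quarters_pow_half_le (n : ℕ) :
    (3 / 4 : ℝ≥0∞) ^ (n / 2) ≤ 2 * ((7 / 8 : ℝ≥0) : ℝ≥0∞) ^ n := by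
  have h : (3 / 4 : ℝ≥0) ^ (n / 2) ≤ 2 * (7 / 8 : ℝ≥0) ^ n := by
    calc (3 / 4 : ℝ≥0) ^ (n / 2) ≤ ((7 / 8) ^ 2) ^ (n / 2) := by
          gcongr
          rw [← NNReal.coe_le_coe]; push_cast; norm_num
      _ = (7 / 8) ^ (2 * (n / 2)) := by rw [pow_mul]
      _ ≤ 2 * (7 / 8) ^ (2 * (n / 2) + n % 2) := by
          rcases Nat.mod_two_eq_zero_or_one n with h | h <;> rw [h]
          · rw [add_zero]; exact le_mul_of_one_le_left (zero_le) (by norm_num)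
          · rw [pow_succ, mul_left_comm]
            refine le_mul_of_one_le_right (zero_le) ?_
            rw [← NNReal.coe_le_coe]; push_cast; norm_num
      _ = _ := by rw [Nat.div_add_mod]
  have h' := ENNReal.coe_le_coe.2 h
  have e : ((3 / 4 : ℝ≥0) : ℝ≥0∞) = 3 / 4 := by
    rw [ENNReal.coe_div (by norm_num)]; rfl
  rw [ENNReal.coe_pow, e, ENNReal.coe_mul, ENNReal.coe_pow] at h'
  exact_mod_cast h'

end PairedTent

theorem mainTheorem8 {Ω : Type*} [MeasurableSpace Ω] (P : Measure Ω) [IsProbabilityMeasure P]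
    (σ : Ω ≃ᵐ Ω) (hσ : Ergodic σ P) (a b : Ω → ℝ) (ha : Measurable a) (hb : Measurable b)
    (ha01 : ∀ ω, a ω ∈ Icc (0 : ℝ) 1) (hb01 : ∀ ω, b ω ∈ Icc (0 : ℝ) 1)
    (hab : ∫ ω, (a ω + b ω) ∂P ≠ 0)
    (hfin : ∀ ε, PairedTent.Admissible a b ε → (range (PairedTent.randomTent a b ε)).Finite)
    (hskew : ∀ ε, PairedTent.Admissible a b ε →
      Measurable fun p : Ω × ℝ => (σ p.1, PairedTent.randomTent a b ε p.1 p.2)) :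
    (∀ ε, PairedTent.Admissible a b ε → ∀ (ω : Ω) (f : ℝ → ℝ), PairedTent.MemBV f → ∀ n : ℕ,
      PairedTent.Var (PairedTent.cocycle σ (PairedTent.tentOp a b ε) n ω f) ≤
        (3 / 4 : ℝ≥0∞) ^ (n / 2) * PairedTent.Var f + 26 * eLpNorm f 1 PairedTent.normLebI) ∧
    PairedTent.UniformLasotaYorke σ (PairedTent.Admissible a b) (PairedTent.tentOp a b) := by
  -- The pair `2`, `7/8` is that of `three_quarters_pow_half_le`; `14` is `13` from the variation
  -- plus `1` from the `L¹` part of the norm.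
  refine ⟨fun ε hε ω f hf n => ?_, 2, 14, 7 / 8, 1, by norm_num, by norm_num, by norm_num, ?_,
    le_rfl, fun ε hε ω f hf n => ?_⟩
  · rw [PairedTent.eLpNorm_normLebI]
    exact PairedTent.Var_cocycle_le hε ha01 hb01 ω (memLp_one_iff_integrable.1 hf.1) n
  · rw [← NNReal.coe_lt_coe]; push_cast; norm_num
  · have hi := memLp_one_iff_integrable.1 hf.1
    have hV := PairedTent.Var_cocycle_le (σ := σ) hε ha01 hb01 ω hi n
    have hN := PairedTent.eLpNorm_cocycle_le (σ := σ) hε ha01 hb01 ω hi n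
    refine ⟨⟨memLp_one_iff_integrable.2 (PairedTent.integrable_cocycle ω hi n), ?_⟩, ?_⟩
    · refine ne_top_of_le_ne_top (ENNReal.add_ne_top.2 ⟨ENNReal.mul_ne_top ?_ hf.2,
        ENNReal.mul_ne_top (by norm_num) hf.1.2.ne⟩) hV
      exact ENNReal.pow_ne_top (ENNReal.div_ne_top (by norm_num) (by norm_num))
    · calc PairedTent.bvNorm _
          ≤ ((3 / 4 : ℝ≥0∞) ^ (n / 2) * PairedTent.Var f + 13 * eLpNorm f 1 PairedTent.lebI) +
            eLpNorm f 1 PairedTent.lebI := add_le_add hV hN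
        _ = (3 / 4 : ℝ≥0∞) ^ (n / 2) * PairedTent.Var f + 14 * eLpNorm f 1 PairedTent.lebI := by
          ring
        _ ≤ 2 * ((7 / 8 : ℝ≥0) : ℝ≥0∞) ^ n * PairedTent.bvNorm f +
            14 * eLpNorm f 1 PairedTent.lebI := by
          gcongr
          · exact PairedTent.three_quarters_pow_half_le n
          · exact le_self_add
        _ = _ := by simp
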